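/- Let $n\ge 1$ and $r\ge 2$ be integers, and let $A$ be an $n\times n$ real matrix with nonnegative entries that is $r$-potent, i.e. $A^r=A$. Call a set $\mathcal S$ of real $n\times n$ matrices decomposable if there are a permutation matrix $P$ and an integer $k$ with $0<k<n$ such that, for every $S\in\mathcal S$, $$P^{-1}SP=\begin{pmatrix} B & C\\ 0 & D\end{pmatrix}$$ with $B$ of size $k\times k$ and $D$ of size $(n-k)\times(n-k)$ (the blocks $B,C,D$ may depend on $S$). Then the multiplicative semigroup $\mathcal S$ generated by $A$ is $\mathcal S=\{A,A^2,\dots,A^{r-1}\}$, and: 1. If $\operatorname{rank}(A)>r-1$, then $\mathcal S$ is decomposable. 2. If $n\ge 2$, $r\ge 3$, $\operatorname{rank}(A)\le r-1$, $A$ is singular, and each of the matrices $A^2,A^3,\dots,A^{r-1}$ has at least one diagonal entry equal to zero, then $\mathcal S$ is decomposable. -/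

import Mathlib

/-- A square matrix is entrywise nonnegative. -/
def Matrix.EntrywiseNonneg {n : ℕ} (A : Matrix (Fin n) (Fin n) ℝ) : Prop :=
  ∀ i j, 0 ≤ A i j

/-- A square matrix `A` is `r`-potent if `A ^ r = A`. -/
def Matrix.IsRPotent {n : ℕ} (A : Matrix (Fin n) (Fin n) ℝ) (r : ℕ) : Prop :=
  A ^ r = A

/-- `M` has the block form `[B C; 0 D]` where `B` is `k × k` and `D` is `(n - k) × (n - k)`. -/
def Matrix.IsBlockUpper {n : ℕ} (k : ℕ) (M : Matrix (Fin n) (Fin n) ℝ) : Prop :=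
  ∀ i j : Fin n, k ≤ (i : ℕ) → (j : ℕ) < k → M i j = 0

/-- A set of `n × n` matrices (in particular a semigroup) is decomposable if there is one
permutation matrix `P` such that all `P⁻¹ A P`, for `A` in the set, have a common block form
`[B C; 0 D]` with `B`, `D` square blocks of positive size. -/
def Matrix.IsDecomposableSet {n : ℕ} (S : Set (Matrix (Fin n) (Fin n) ℝ)) : Prop :=
  ∃ (σ : Equiv.Perm (Fin n)) (k : ℕ), 0 < k ∧ k < n ∧
    ∀ A ∈ S, Matrix.IsBlockUpper k ((σ.permMatrix ℝ)⁻¹ * A * σ.permMatrix ℝ)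

namespace Matrix

variable {n : ℕ} {A E : Matrix (Fin n) (Fin n) ℝ} {r : ℕ}

/-! Read `0 < (A ^ k) i j` as a walk of length `k` from `i` to `j`. If some pair is joined by no
walk, the indices reachable from the source give a common block form. Otherwise `E = A ^ (r - 1)` is
an idempotent whose support is an equivalence relation. Walk lengths from a base index, taken mod `r
- 1`, show at most `r - 1` classes. On each class the rows of `E` are proportional up to the factor
`E *ᵥ 1`, so `rank A ≤ rank E ≤ r - 1`, giving part 1. For part 2, a zero diagonal entry of `E`
means no closed walk at that index. -/

theorem IsRPotent.pow_add_mul (hr : 2 ≤ r) (h : A.IsRPotent r) {m : ℕ} (hm : 1 ≤ m) (t : ℕ) :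
    A ^ (m + (r - 1) * t) = A ^ m := by
  induction t with
  | zero => simp
  | succ t ih =>
    have e : m + (r - 1) * (t + 1) = r + (m + (r - 1) * t - 1) := by
      rw [mul_add]; omega
    rw [e, pow_add, show A ^ r = A from h, ← pow_succ', Nat.sub_add_cancel (by omega), ih]

theorem IsRPotent.pow_mul_eq (hr : 2 ≤ r) (h : A.IsRPotent r) {t : ℕ} (ht : 1 ≤ t) :
    A ^ ((r - 1) * t) = A ^ (r - 1) := by
  obtain ⟨t, rfl⟩ := Nat.exists_eq_add_of_le ht
  rw [mul_add, mul_one]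
  exact h.pow_add_mul hr (by omega) t

theorem IsRPotent.closure_eq (hr : 2 ≤ r) (h : A.IsRPotent r) :
    ((Subsemigroup.closure {A} : Subsemigroup (Matrix (Fin n) (Fin n) ℝ)) :
        Set (Matrix (Fin n) (Fin n) ℝ)) = {B | ∃ k : ℕ, 1 ≤ k ∧ k ≤ r - 1 ∧ B = A ^ k} := by
  have reduce : ∀ m : ℕ, 1 ≤ m → ∃ k : ℕ, 1 ≤ k ∧ k ≤ r - 1 ∧ A ^ m = A ^ k := by
    intro m hm
    refine ⟨(m - 1) % (r - 1) + 1, by omega, Nat.mod_lt _ (by omega), ?_⟩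
    have e : m = (m - 1) % (r - 1) + 1 + (r - 1) * ((m - 1) / (r - 1)) := by
      have := Nat.mod_add_div (m - 1) (r - 1)
      omega
    conv_lhs => rw [e]
    exact h.pow_add_mul hr (by omega) _
  ext B
  constructor
  · intro hB
    induction hB using Subsemigroup.closure_induction with
    | mem x hx => exact ⟨1, le_rfl, by omega, by simpa using hx⟩
    | mul x y _ _ hx hy =>
      obtain ⟨k, hk, -, rfl⟩ := hx
      obtain ⟨l, hl, -, rfl⟩ := hy
      obtain ⟨m, h1, h2, h3⟩ := reduce (k + l) (by omega)
      exact ⟨m, h1, h2, by rw [← pow_add, h3]⟩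
  · rintro ⟨k, hk, -, rfl⟩
    induction k, hk using Nat.le_induction with
    | base => simpa using Subsemigroup.subset_closure (Set.mem_singleton A)
    | succ k _ ih =>
      rw [pow_succ]
      exact mul_mem ih (Subsemigroup.subset_closure (Set.mem_singleton A))

theorem permMatrix_inv_mul_mul_apply (σ : Equiv.Perm (Fin n)) (M : Matrix (Fin n) (Fin n) ℝ)
    (i j : Fin n) :
    ((σ.permMatrix ℝ)⁻¹ * M * σ.permMatrix ℝ) i j = M (σ.symm i) (σ.symm j) := by
  have hinv : (σ.permMatrix ℝ)⁻¹ = σ⁻¹.permMatrix ℝ := by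
    apply Matrix.inv_eq_left_inv
    rw [← Matrix.permMatrix_mul]
    simp
  rw [hinv, Equiv.Perm.permMatrix, Equiv.Perm.permMatrix, PEquiv.mul_toMatrix_toPEquiv,
    PEquiv.toMatrix_toPEquiv_mul]
  rfl

/-- A proper nonempty set of indices which no power of `A` leaves gives a common block form. -/
theorem isDecomposableSet_of_closed {S : Finset (Fin n)} (hne : S.Nonempty) (hS : S ≠ Finset.univ)
    {T : Set (Matrix (Fin n) (Fin n) ℝ)} (hT : ∀ M ∈ T, ∀ i ∈ S, ∀ j ∉ S, M i j = 0) :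
    IsDecomposableSet T := by
  have hcard : Sᶜ.card = n - S.card := by simp [Finset.card_compl]
  have hpos := hne.card_pos
  have hlt : S.card < n := by
    simpa using Finset.card_lt_card (Finset.ssubset_univ_iff.2 hS)
  have e : {i : Fin n // (i : ℕ) < n - S.card} ≃ {i : Fin n // i ∉ S} := by
    apply Fintype.equivOfCardEq
    rw [Fintype.card_subtype, Fintype.card_subtype]
    have h1 : (Finset.univ.filter fun i : Fin n => i ∉ S) = Sᶜ := by ext; simp
    rw [h1, hcard, Fin.card_filter_val_lt]
    omega
  -- The complement of `S` goes first, so the rows in `S` form the lower blocks.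
  refine ⟨(e.extendSubtype).symm, n - S.card, by omega, by omega, fun M hM i j hi hj => ?_⟩
  rw [permMatrix_inv_mul_mul_apply]
  apply hT M hM
  · by_contra hc
    exact absurd hc (e.extendSubtype_not_mem i (by omega))
  · exact e.extendSubtype_mem j hj

theorem pow_apply_eq_zero_of_closed {S : Finset (Fin n)} (hS : ∀ i ∈ S, ∀ j ∉ S, A i j = 0) {k : ℕ}
    (hk : 1 ≤ k) : ∀ i ∈ S, ∀ j ∉ S, (A ^ k) i j = 0 := by
  induction k, hk using Nat.le_induction with
  | base => simpa using hS
  | succ k _ ih =>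
    intro i hi j hj
    rw [pow_succ, Matrix.mul_apply]
    refine Finset.sum_eq_zero fun l _ => ?_
    by_cases hl : l ∈ S
    · rw [hS l hl j hj, mul_zero]
    · rw [ih i hi l hl, zero_mul]

theorem EntrywiseNonneg.mul {B : Matrix (Fin n) (Fin n) ℝ} (hA : A.EntrywiseNonneg)
    (hB : B.EntrywiseNonneg) : (A * B).EntrywiseNonneg := fun i j => by
  rw [Matrix.mul_apply]
  exact Finset.sum_nonneg fun l _ => mul_nonneg (hA i l) (hB l j)

theorem EntrywiseNonneg.pow (hA : A.EntrywiseNonneg) (k : ℕ) : (A ^ k).EntrywiseNonneg := by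
  induction k with
  | zero =>
    intro i j
    rw [pow_zero, Matrix.one_apply]
    split_ifs <;> norm_num
  | succ k ih =>
    rw [pow_succ]
    exact ih.mul hA

theorem EntrywiseNonneg.mul_apply_pos {B : Matrix (Fin n) (Fin n) ℝ} (hA : A.EntrywiseNonneg)
    (hB : B.EntrywiseNonneg) {i l j : Fin n} (h1 : 0 < A i l) (h2 : 0 < B l j) :
    0 < (A * B) i j := by
  rw [Matrix.mul_apply]
  exact Finset.sum_pos' (fun l _ => mul_nonneg (hA i l) (hB l j))
    ⟨l, Finset.mem_univ _, mul_pos h1 h2⟩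

theorem EntrywiseNonneg.pow_add_apply_pos (hA : A.EntrywiseNonneg) {a b : ℕ} {i l j : Fin n}
    (h1 : 0 < (A ^ a) i l) (h2 : 0 < (A ^ b) l j) : 0 < (A ^ (a + b)) i j := by
  rw [pow_add]
  exact (hA.pow a).mul_apply_pos (hA.pow b) h1 h2

theorem EntrywiseNonneg.pow_mul_apply_pos (hA : A.EntrywiseNonneg) {a : ℕ} {i : Fin n}
    (h : 0 < (A ^ a) i i) (t : ℕ) : 0 < (A ^ (a * t)) i i := by
  induction t with
  | zero => simp
  | succ t ih => exact hA.pow_add_apply_pos ih h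

/-- If two indices are not joined by a walk, all positive powers have a common block form. -/
theorem EntrywiseNonneg.isDecomposableSet_of_not_joined (hn : 2 ≤ n) (hA : A.EntrywiseNonneg)
    {i j : Fin n} (hij : ∀ k, 1 ≤ k → ¬ 0 < (A ^ k) i j) {T : Set (Matrix (Fin n) (Fin n) ℝ)}
    (hT : ∀ M ∈ T, ∃ k, 1 ≤ k ∧ M = A ^ k) : IsDecomposableSet T := by
  classical
  suffices h : ∃ S : Finset (Fin n), S.Nonempty ∧ S ≠ Finset.univ ∧
      ∀ a ∈ S, ∀ b ∉ S, A a b = 0 by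
    obtain ⟨S, h1, h2, h3⟩ := h
    refine isDecomposableSet_of_closed h1 h2 fun M hM => ?_
    obtain ⟨k, hk, rfl⟩ := hT M hM
    exact pow_apply_eq_zero_of_closed h3 hk
  set S : Finset (Fin n) := Finset.univ.filter fun l => ∃ k, 1 ≤ k ∧ 0 < (A ^ k) i l with hS
  by_cases hne : S.Nonempty
  · refine ⟨S, hne, fun h => ?_, fun a ha b hb => ?_⟩
    · have hj : j ∈ S := h ▸ Finset.mem_univ j
      obtain ⟨k, hk, hk'⟩ := (Finset.mem_filter.1 hj).2
      exact hij k hk hk'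
    · obtain ⟨k, hk, hk'⟩ := (Finset.mem_filter.1 ha).2
      by_contra h0
      have hab : 0 < (A ^ 1) a b := by
        rw [pow_one]
        exact lt_of_le_of_ne (hA a b) (Ne.symm h0)
      exact hb (Finset.mem_filter.2
        ⟨Finset.mem_univ _, k + 1, by omega, hA.pow_add_apply_pos hk' hab⟩)
  -- Nothing is reachable from `i`: its row in `A` is zero and `{i}` itself is closed.
  · refine ⟨{i}, Finset.singleton_nonempty i, fun h => ?_, fun a ha b _ => ?_⟩
    · have := congrArg Finset.card h
      simp at this
      omega
    · rw [Finset.mem_singleton.1 ha]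
      by_contra h0
      refine hne ⟨b, Finset.mem_filter.2 ⟨Finset.mem_univ _, 1, le_rfl, ?_⟩⟩
      rw [pow_one]
      exact lt_of_le_of_ne (hA i b) (Ne.symm h0)

/-- For a nonnegative matrix whose support is symmetric and transitive, fixed vectors are
proportional to a positive fixed vector along the support. -/
theorem EntrywiseNonneg.fixed_proportional (hE : E.EntrywiseNonneg)
    (hsymm : ∀ i j, 0 < E i j → 0 < E j i)
    (htrans : ∀ i j k, 0 < E i j → 0 < E j k → 0 < E i k)
    {v x : Fin n → ℝ} (hv : ∀ i, 0 < v i) (hEv : E *ᵥ v = v) (hEx : E *ᵥ x = x)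
    {i j : Fin n} (hij : 0 < E i j) : x i * v j = x j * v i := by
  classical
  set C : Finset (Fin n) := Finset.univ.filter fun k => 0 < E i k with hC
  have hmem : ∀ k, k ∈ C ↔ 0 < E i k := fun k => by simp [hC]
  -- Minimum principle: at a minimiser of `x / v` on the class, the two fixed-point equations make a
  -- sum of nonnegative terms vanish.
  obtain ⟨m, hm, hmin⟩ := C.exists_min_image (fun k => x k / v k) ⟨j, (hmem j).2 hij⟩
  have hzero : ∀ k, 0 < E i k → x k * v m = x m * v k := by
    have hx := congrFun hEx m
    have hw := congrFun hEv m
    simp only [Matrix.mulVec, dotProduct] at hx hw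
    have hsum : ∑ k, E m k * (x k * v m - x m * v k) = 0 := by
      simp only [mul_sub, Finset.sum_sub_distrib]
      have e1 : ∑ k, E m k * (x k * v m) = x m * v m := by
        conv_rhs => rw [← hx]
        rw [Finset.sum_mul]
        exact Finset.sum_congr rfl fun k _ => by ring
      have e2 : ∑ k, E m k * (x m * v k) = x m * v m := by
        conv_rhs => rw [← hw]
        rw [Finset.mul_sum]
        exact Finset.sum_congr rfl fun k _ => by ring
      rw [e1, e2, sub_self]
    have hnn : ∀ k ∈ Finset.univ, 0 ≤ E m k * (x k * v m - x m * v k) := by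
      intro k _
      rcases (hE m k).eq_or_lt with h0 | h0
      · simp [← h0]
      · have hk := hmin k ((hmem k).2 (htrans i m k ((hmem m).1 hm) h0))
        rw [div_le_div_iff₀ (hv m) (hv k)] at hk
        exact mul_nonneg h0.le (sub_nonneg.2 hk)
    intro k hk
    have hmk : 0 < E m k := htrans m i k (hsymm _ _ ((hmem m).1 hm)) hk
    have := (Finset.sum_eq_zero_iff_of_nonneg hnn).1 hsum k (Finset.mem_univ k)
    rcases mul_eq_zero.1 this with h | h
    · exact absurd h hmk.ne'
    · linarith
  have hi := hzero i (htrans _ _ _ hij (hsymm _ _ hij))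
  have hj := hzero j hij
  have hvm := (hv m).ne'
  apply mul_right_cancel₀ hvm
  linear_combination v j * hi - v i * hj

/-- The rank of a nonnegative idempotent is at most the number of colours in a colouring of the
indices whose colour classes are contained in classes of the support. -/
theorem EntrywiseNonneg.rank_le_of_coloring (hE : E.EntrywiseNonneg) (hidem : E * E = E)
    (hsymm : ∀ i j, 0 < E i j → 0 < E j i) {a : ℕ} (d : Fin n → Fin a)
    (hd : ∀ i j, d i = d j → 0 < E i j) : E.rank ≤ a := by
  classical
  have htrans : ∀ i j k, 0 < E i j → 0 < E j k → 0 < E i k := fun i j k h1 h2 => by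
    rw [← hidem]
    exact hE.mul_apply_pos hE h1 h2
  set v : Fin n → ℝ := E *ᵥ 1 with hvdef
  have hv : ∀ i, 0 < v i := fun i => by
    simp only [hvdef, Matrix.mulVec, dotProduct, Pi.one_apply, mul_one]
    exact Finset.sum_pos' (fun l _ => hE i l) ⟨i, Finset.mem_univ _, hd i i rfl⟩
  have hEv : E *ᵥ v = v := by rw [hvdef, Matrix.mulVec_mulVec, hidem]
  let V : Matrix (Fin n) (Fin a) ℝ := fun i c => if d i = c then v i else 0
  -- Row `c` is the row of `E` at one representative of colour `c`, scaled by `v`.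
  let W : Matrix (Fin a) (Fin n) ℝ := fun c j =>
    if h : ∃ k, d k = c then E h.choose j / v h.choose else 0
  have hVW : E = V * W := by
    ext i j
    have hex : ∃ k, d k = d i := ⟨i, rfl⟩
    rw [Matrix.mul_apply, Finset.sum_eq_single (d i)
      (fun c _ hc => by simp [V, Ne.symm hc]) (fun h => absurd (Finset.mem_univ _) h)]
    simp only [V, W, if_true, dif_pos hex]
    have hcol : E *ᵥ (fun k => E k j) = fun k => E k j := by
      funext k
      exact congrFun (congrFun hidem k) j
    have := hE.fixed_proportional hsymm htrans hv hEv hcol (hd i _ hex.choose_spec.symm)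
    rw [mul_div_assoc', eq_div_iff (hv _).ne', this, mul_comm]
  rw [hVW]
  calc (V * W).rank ≤ V.rank := Matrix.rank_mul_le_left V W
    _ ≤ a := by simpa using V.rank_le_card_width

theorem IsRPotent.pow_pred_apply_pos (hr : 2 ≤ r) (h : A.IsRPotent r) {m : ℕ} (hm : 1 ≤ m)
    (hdvd : r - 1 ∣ m) {i j : Fin n} (hij : 0 < (A ^ m) i j) : 0 < (A ^ (r - 1)) i j := by
  obtain ⟨t, rfl⟩ := hdvd
  rwa [h.pow_mul_eq hr (Nat.pos_of_ne_zero (by rintro rfl; simp at hm))] at hij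

/-- Going round a closed walk `r - 1` times makes its length a multiple of `r - 1`. -/
theorem IsRPotent.pow_pred_diag_pos (hr : 2 ≤ r) (hA : A.EntrywiseNonneg) (h : A.IsRPotent r)
    {k : ℕ} (hk : 1 ≤ k) {i : Fin n} (hi : 0 < (A ^ k) i i) : 0 < (A ^ (r - 1)) i i :=
  h.pow_pred_apply_pos hr (Nat.mul_pos hk (by omega : 0 < r - 1)) (dvd_mul_left _ _)
    (hA.pow_mul_apply_pos hi (r - 1))

/-- Two walks from a common index with lengths congruent modulo `r - 1` have ends joined in
`A ^ (r - 1)`. -/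
theorem IsRPotent.pow_pred_apply_pos_of_modEq (hr : 2 ≤ r) (hA : A.EntrywiseNonneg)
    (h : A.IsRPotent r) {i j l : Fin n} {a b c : ℕ} (ha : 1 ≤ a) (hij : 0 < (A ^ a) i j)
    (hil : 0 < (A ^ b) i l) (hji : 0 < (A ^ c) j i) (hab : a ≡ b [MOD r - 1]) :
    0 < (A ^ (r - 1)) j l := by
  -- Go round `j → i → j` `r - 2` times, then `j → i → l`: the length is congruent to `(c + a) * (r
  -- - 1)`.
  have hjl := hA.pow_add_apply_pos
    (hA.pow_mul_apply_pos (hA.pow_add_apply_pos hji hij) (r - 2))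
    (hA.pow_add_apply_pos hji hil)
  -- Length zero forces `j = i = l`; the closed walk of length `a ≥ 1` then serves.
  rcases Nat.eq_zero_or_pos ((c + a) * (r - 2) + (c + b)) with h0 | h0
  · have hc : c = 0 := by omega
    have hb : b = 0 := by omega
    subst hc hb
    have : j = i ∧ i = l := by
      constructor
      · by_contra hne
        simp [hne] at hji
      · by_contra hne
        simp [hne] at hil
    obtain ⟨rfl, rfl⟩ := this
    exact h.pow_pred_diag_pos hr hA ha hij
  · refine h.pow_pred_apply_pos hr h0 ?_ hjl
    rw [← Nat.modEq_zero_iff_dvd]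
    have h1 : (c + a) * (r - 2) + (c + b) ≡ (c + a) * (r - 2) + (c + a) [MOD r - 1] :=
      ((hab.symm).add_left c).add_left _
    refine h1.trans ?_
    rw [Nat.modEq_zero_iff_dvd, ← Nat.mul_succ, Nat.succ_eq_add_one,
      show r - 2 + 1 = r - 1 by omega]
    exact dvd_mul_left _ _

/-- A nonnegative `r`-potent matrix with all indices joined by walks has rank at most `r - 1`. -/
theorem IsRPotent.rank_le_of_joined (hr : 2 ≤ r) (hA : A.EntrywiseNonneg) (h : A.IsRPotent r)
    (hj : ∀ i j, ∃ k, 1 ≤ k ∧ 0 < (A ^ k) i j) : A.rank ≤ r - 1 := by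
  rcases Nat.eq_zero_or_pos n with rfl | hn
  · exact (A.rank_le_height).trans (Nat.zero_le _)
  have hrank : A.rank ≤ (A ^ (r - 1)).rank := by
    conv_lhs => rw [← show A ^ r = A from h, ← Nat.sub_add_cancel (show 1 ≤ r by omega), pow_succ]
    exact Matrix.rank_mul_le_left _ _
  refine hrank.trans ?_
  choose w hw1 hw using hj
  have hidem : A ^ (r - 1) * A ^ (r - 1) = A ^ (r - 1) := by
    rw [← pow_add, ← mul_two]
    exact h.pow_mul_eq hr (by omega)
  refine (hA.pow (r - 1)).rank_le_of_coloring hidem (fun i j hij => ?_)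
    -- The colour of `i` is the length mod `r - 1` of a chosen walk from index `0`.
    (fun i => ⟨w ⟨0, hn⟩ i % (r - 1), Nat.mod_lt _ (by omega)⟩) (fun i j hij => ?_)
  · refine h.pow_pred_apply_pos_of_modEq hr hA (by omega) hij
      (h.pow_pred_diag_pos hr hA (hw1 i i) (hw i i)) (hw j i) rfl
  · exact h.pow_pred_apply_pos_of_modEq hr hA (hw1 _ _) (hw ⟨0, hn⟩ i) (hw _ j) (hw i _)
      (congrArg Fin.val hij)

end Matrix

theorem mainTheorem8 {n : ℕ} (r : ℕ) (hr : 2 ≤ r) (A : Matrix (Fin n) (Fin n) ℝ)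
    (hA : A.EntrywiseNonneg) (hAr : A.IsRPotent r) :
    ((Subsemigroup.closure {A} : Subsemigroup (Matrix (Fin n) (Fin n) ℝ)) :
        Set (Matrix (Fin n) (Fin n) ℝ)) = {B | ∃ k : ℕ, 1 ≤ k ∧ k ≤ r - 1 ∧ B = A ^ k} ∧
    (r - 1 < A.rank →
      Matrix.IsDecomposableSet
        ((Subsemigroup.closure {A} : Subsemigroup (Matrix (Fin n) (Fin n) ℝ)) :
          Set (Matrix (Fin n) (Fin n) ℝ))) ∧
    (2 ≤ n → 3 ≤ r → A.rank ≤ r - 1 → A.det = 0 →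
      (∀ k : ℕ, 2 ≤ k → k ≤ r - 1 → ∃ i, (A ^ k) i i = 0) →
      Matrix.IsDecomposableSet
        ((Subsemigroup.closure {A} : Subsemigroup (Matrix (Fin n) (Fin n) ℝ)) :
          Set (Matrix (Fin n) (Fin n) ℝ))) := by

  have hpow : ∀ M ∈ ((Subsemigroup.closure {A} : Subsemigroup (Matrix (Fin n) (Fin n) ℝ)) :
      Set (Matrix (Fin n) (Fin n) ℝ)), ∃ k, 1 ≤ k ∧ M = A ^ k := by
    intro M hM
    rw [hAr.closure_eq hr] at hM
    obtain ⟨k, hk, -, rfl⟩ := hM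
    exact ⟨k, hk, rfl⟩
  refine ⟨hAr.closure_eq hr, fun hrank => ?_, fun hn hr3 _ _ hdiag => ?_⟩
  · have hn : 2 ≤ n := by
      have := A.rank_le_height
      omega
    by_contra hdec
    refine absurd (hAr.rank_le_of_joined hr hA fun i j => ?_) (not_le.2 hrank)
    by_contra! hij
    exact hdec (hA.isDecomposableSet_of_not_joined hn (fun k hk => not_lt.2 (hij k hk)) hpow)
  · obtain ⟨i, hi⟩ := hdiag (r - 1) (by omega) le_rfl
    exact hA.isDecomposableSet_of_not_joined hn
      (fun k hk hpos => (hAr.pow_pred_diag_pos hr hA hk hpos).ne' hi) hpow
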